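/- Let $N\ge 1$, let $p\ge 1$ be real and let $m\ge 0$. For finite nonnegative Borel measures $\mu,\nu$ on $\mathbb R^N$ of equal mass put $W_p(\mu,\nu)=\inf_\pi\big(\iint|x-y|^p\,d\pi(x,y)\big)^{1/p}$, the infimum being over nonnegative Borel measures $\pi$ on $\mathbb R^N\times\mathbb R^N$ with marginals $\mu$ and $\nu$. Let \[ \mathsf A_m=\Big\{\rho\in L^1(\mathbb R^N): 0\le\rho\le 1 \text{ a.e.},\ \int\rho\,dx=m\Big\}. \] For $\rho\in\mathsf A_m$, and for a measurable set $E\subset\mathbb R^N$ with $|E|=m$, let \[ \mathcal W_p(\rho)=\inf\Big\{W_p(\rho\,dx,\rho'\,dx): \rho'\ge 0,\ \rho+\rho'\le 1,\ \int\rho'\,dx=\int\rho\,dx\Big\}, \] \[ \mathcal W_p(E)=\inf\Big\{W_p(\mathbf 1_E\,dx,\mathbf 1_F\,dx): |F|=|E|,\ |E\cap F|=0\Big\}. \] Give $\mathsf A_m$ the weak* topology: $\rho_n\overset{*}{\rightharpoonup}\rho$ means $\int\varphi\rho_n\,dx\to\int\varphi\rho\,dx$ for every $\varphi\in C_0(\mathbb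 R^N)$ (continuous and vanishing at infinity). (All $\rho_n$ and the limit $\rho$ have the same mass $m$, so no mass is lost.) Then $\mathcal W_p(\rho)<\infty$ for every $\rho\in\mathsf A_m$, and: (i) if $p>1$, $\rho_n,\rho\in\mathsf A_m$ and $\rho_n\overset{*}{\rightharpoonup}\rho$, then $\lim_n\mathcal W_p(\rho_n)$ exists and equals $\mathcal W_p(\rho)$; (ii) for every $p\ge 1$, the functional $\rho\mapsto\mathcal W_p(\rho)$ on $\mathsf A_m$ is the lower semicontinuous envelope, for the weak* topology, of the functional which equals $\mathcal W_p(E)$ at $\rho=\mathbf 1_E$ and $+\infty$ at all other densities; that is, it is the largest weak* lower semicontinuous functional below it. Moreover, for every $\rho\in\mathsf A_m$, \[ \mathcal W_p(\rho)=\min\Big\{\liminf_{n\to\infty}\mathcal W_p(E_n): |E_n|=m,\ \mathbf 1_{E_n}\overset{*}{\rightharpoonup}\rho\Big\}, \] where the minimum is over sequences of measurable sets and is attained. -/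

import Mathlib

open MeasureTheory Filter Topology
open scoped ENNReal NNReal ZeroAtInfty

noncomputable section

namespace WassersteinEnergy

/-- The `p`-Wasserstein distance
`W_p(μ, ν) = (inf {∬ |x - y|^p dπ : (p₁)_# π = μ, (p₂)_# π = ν})^(1/p)`, with values in `[0, ∞]`;
the infimum over the empty set of plans is `∞`. -/
def wassersteinDist {X : Type*} [PseudoEMetricSpace X] [MeasurableSpace X]
    (p : ℝ) (μ ν : Measure X) : ℝ≥0∞ :=
  (⨅ (π : Measure (X × X)) (_ : π.map Prod.fst = μ) (_ : π.map Prod.snd = ν),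
    ∫⁻ z, edist z.1 z.2 ^ p ∂π) ^ (1 / p)

/-- The measure `ρ 𝓛^N`, for a nonnegative density `ρ`. -/
def densityMeasure {N : ℕ} (ρ : EuclideanSpace ℝ (Fin N) → ℝ) :
    Measure (EuclideanSpace ℝ (Fin N)) :=
  volume.withDensity fun x => ENNReal.ofReal (ρ x)

/-- The energy of a set `E`:
`inf {W_p(𝓛^N ⌞ E, 𝓛^N ⌞ F) : |F| = |E|, |E ∩ F| = 0}`. -/
def setEnergy {N : ℕ} (p : ℝ) (E : Set (EuclideanSpace ℝ (Fin N))) : ℝ≥0∞ :=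
  ⨅ (F : Set (EuclideanSpace ℝ (Fin N))) (_ : MeasurableSet F)
    (_ : volume F = volume E) (_ : volume (E ∩ F) = 0),
    wassersteinDist p (volume.restrict E) (volume.restrict F)

/-- The energy of a density `ρ`:
`inf {W_p(ρ, ρ') : 0 ≤ ρ', ρ + ρ' ≤ 1, ∫ ρ' = ∫ ρ}`. -/
def energy {N : ℕ} (p : ℝ) (ρ : EuclideanSpace ℝ (Fin N) → ℝ) : ℝ≥0∞ :=
  ⨅ (ρ' : EuclideanSpace ℝ (Fin N) → ℝ) (_ : Integrable ρ')
    (_ : ∀ᵐ x, 0 ≤ ρ' x) (_ : ∀ᵐ x, ρ x + ρ' x ≤ 1) (_ : ∫ x, ρ' x = ∫ x, ρ x),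
    wassersteinDist p (densityMeasure ρ) (densityMeasure ρ')

/-- The class `A_m` of admissible densities of mass `m` (given by representatives; nothing below
distinguishes functions that agree almost everywhere). -/
structure AdmissibleDensity (N : ℕ) (m : ℝ≥0) where
  toFun : EuclideanSpace ℝ (Fin N) → ℝ
  integrable : Integrable toFun
  nonneg : ∀ᵐ x, 0 ≤ toFun x
  le_one : ∀ᵐ x, toFun x ≤ 1
  integral_eq : ∫ x, toFun x = m

/-- The weak* topology on `A_m`, as a set of measures, that is, of elements of the dual of
`C₀(ℝ^N)`: the coarsest topology for which `ρ ↦ ∫ φ ρ dx` is continuous for all `φ ∈ C₀(ℝ^N)`. -/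
instance AdmissibleDensity.instTopologicalSpace (N : ℕ) (m : ℝ≥0) :
    TopologicalSpace (AdmissibleDensity N m) :=
  TopologicalSpace.induced
    (fun ρ => fun φ : C₀(EuclideanSpace ℝ (Fin N), ℝ) => ∫ x, φ x * ρ.toFun x)
    inferInstance

/-- Measurable sets of Lebesgue measure `m`. -/
structure AdmissibleSet (N : ℕ) (m : ℝ≥0) where
  carrier : Set (EuclideanSpace ℝ (Fin N))
  measurableSet : MeasurableSet carrier
  volume_eq : volume carrier = m

/-- The characteristic function of a set of measure `m`, as an element of `A_m`. -/
def AdmissibleSet.toDensity {N : ℕ} {m : ℝ≥0} (E : AdmissibleSet N m) :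
    AdmissibleDensity N m where
  toFun := E.carrier.indicator fun _ => 1
  integrable := by
    refine (integrable_indicator_iff E.measurableSet).2 (integrableOn_const ?_ (by simp))
    simp [E.volume_eq]
  nonneg := Eventually.of_forall fun _ => Set.indicator_nonneg (fun _ _ => zero_le_one) _
  le_one := Eventually.of_forall fun x =>
    Set.indicator_le_self' (f := fun _ => (1 : ℝ)) (fun _ _ => zero_le_one) x
  integral_eq := by
    rw [integral_indicator E.measurableSet]
    simp [Measure.real, E.volume_eq]

/-- The set energy as a functional on `A_m`, equal to `∞` at every density that is not
(almost everywhere) a characteristic function. -/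
def extendedSetEnergy {N : ℕ} {m : ℝ≥0} (p : ℝ) (ρ : AdmissibleDensity N m) : ℝ≥0∞ :=
  ⨅ (E : AdmissibleSet N m) (_ : ρ.toFun =ᵐ[volume] E.toDensity.toFun), setEnergy p E.carrier

/-- `G` is the lower semicontinuous envelope of `F`: the largest lower semicontinuous functional
that lies below `F`. -/
def IsLscEnvelope {X : Type*} [TopologicalSpace X] (F G : X → ℝ≥0∞) : Prop :=
  IsGreatest {H : X → ℝ≥0∞ | LowerSemicontinuous H ∧ ∀ x, H x ≤ F x} G

end WassersteinEnergy

end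

/-!
The energy is weak* continuous on `A_m` for every `p ≥ 1`, and it agrees with the set energy on
characteristic functions. As these are weak* dense, continuity, the envelope property and the
formula for the minimum all follow. No compactness of plans and no duality is needed: everything is
done by rearranging mass inside the cells of grids of cubes.

* **Transfer** (`exists_plan_cost_le_add`). Let `π` be a plan and let `σ`, `τ` give the same mass as
  the marginals of `π` to every cell of a partition into sets of diameter at most `d`. Then there
  is a plan between `σ` and `τ` whose `L^p` cost exceeds that of `π` by at most `2 d` times the
  `L^p(π)` norm of the constant `1`.
* **Stability** (`planEnergy_le_add`). Let `ε` be the total excess of `σ` over `μ` on the cells of a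
  fine partition. A plan for `μ` can be cut down, losing mass at most `2 ε`, so that it respects in
  each cell the mass that `σ` offers and the room that `σ` leaves; it is then transferred to `σ`.
  The remaining mass, at most `2 ε`, is moved inside large cubes, each of volume at least twice the
  total mass, so that room is always available there. The same device shows that the energy is
  finite (`energy_ne_top`).
* **Continuity** (`continuous_energy`). If `σ → ρ` weak*, then, the densities being bounded by `1`,
  the mass of each cube converges; as the total masses agree, the excess tends to zero, in both
  directions, by dominated convergence for sums.
* **Sets** (`setEnergy_eq_energy`, `exists_tendsto_toDensity`). Lebesgue measure has no atoms, so
  inside each cube a density can be replaced by a set of the same mass. By transfer this turns a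
  competitor for the energy of `1_E` into a competitor for the set energy at an arbitrarily small
  price, and it also yields sets whose characteristic functions converge to a given density.
-/

namespace WassersteinEnergy

/-! ### Plans and countable partitions -/

theorem tsum_measure_preimage_singleton_inter {X ι : Type*} [MeasurableSpace X]
    [MeasurableSpace ι] [Countable ι] [MeasurableSingletonClass ι] (σ : Measure X) {q : X → ι}
    (hq : Measurable q) (A : Set X) :
    ∑' i, σ (q ⁻¹' {i} ∩ A) = σ A := by
  have h := lintegral_countable' (μ := (σ.restrict A).map q) fun _ => 1
  simp only [lintegral_const, one_mul, Measure.map_apply hq MeasurableSet.univ,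
    Set.preimage_univ, Measure.restrict_apply MeasurableSet.univ, Set.univ_inter] at h
  rw [h]
  refine tsum_congr fun i => ?_
  rw [Measure.map_apply hq (measurableSet_singleton i),
    Measure.restrict_apply (hq (measurableSet_singleton i))]

theorem map_eq_map_of_preimage_singleton {X Y ι : Type*} [MeasurableSpace X] [MeasurableSpace Y]
    [MeasurableSpace ι] [Countable ι] [MeasurableSingletonClass ι] {μ : Measure X}
    {ν : Measure Y} {f : X → ι} {g : Y → ι} (hf : Measurable f) (hg : Measurable g)
    (h : ∀ i, μ (f ⁻¹' {i}) = ν (g ⁻¹' {i})) : μ.map f = ν.map g :=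
  Measure.ext_iff_singleton.2 fun i => by
    rw [Measure.map_apply hf (measurableSet_singleton i),
      Measure.map_apply hg (measurableSet_singleton i), h]

/-- A measure can be decreased so as to give prescribed smaller masses to the cells of a countable
partition. -/
theorem exists_le_preimage_singleton_eq {X ι : Type*} [MeasurableSpace X]
    [MeasurableSpace ι] [Countable ι] [MeasurableSingletonClass ι] (κ : Measure X) {q : X → ι}
    (hq : Measurable q) (hfin : ∀ i, κ (q ⁻¹' {i}) ≠ ∞) {b : ι → ℝ≥0∞}
    (hb : ∀ i, b i ≤ κ (q ⁻¹' {i})) :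
    ∃ κ' ≤ κ, ∀ i, κ' (q ⁻¹' {i}) = b i := by
  refine ⟨κ.withDensity fun x => b (q x) / κ (q ⁻¹' {q x}), ?_, fun i => ?_⟩
  · conv_rhs => rw [← withDensity_one (μ := κ)]
    exact withDensity_mono
      (Eventually.of_forall fun x => ENNReal.div_le_of_le_mul (by simpa using hb _))
  · have hm := hq (measurableSet_singleton i)
    rw [withDensity_apply _ hm, setLIntegral_congr_fun (g := fun _ => b i / κ (q ⁻¹' {i})) hm,
      setLIntegral_const]
    · rcases eq_or_ne (κ (q ⁻¹' {i})) 0 with h0 | h0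
      · simp [h0, (le_antisymm (h0 ▸ hb i) bot_le : b i = 0)]
      · exact ENNReal.div_mul_cancel h0 (hfin i)
    · intro x hx
      simp only [Set.mem_preimage, Set.mem_singleton_iff] at hx
      simp only [hx]

theorem lintegral_cond_apply {X ι : Type*} [MeasurableSpace X]
    [MeasurableSpace ι] [Countable ι] [MeasurableSingletonClass ι] (σ : Measure X) {q : X → ι}
    (hq : Measurable q) (hfin : ∀ i, σ (q ⁻¹' {i}) ≠ ∞) (A : Set X) :
    ∫⁻ i, ProbabilityTheory.cond σ (q ⁻¹' {i}) A ∂(σ.map q) = σ A := by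
  rw [lintegral_countable', ← tsum_measure_preimage_singleton_inter σ hq A]
  refine tsum_congr fun i => ?_
  rw [Measure.map_apply hq (measurableSet_singleton i),
    ProbabilityTheory.cond_mul_eq_inter' (hq (measurableSet_singleton i)) (hfin i)]

/-- A plan `γ` between the measures that `σ` and `τ` induce on the index set of a partition lifts
to a plan between `σ` and `τ`: inside each product of cells, take a multiple of the product
measure. -/
theorem exists_plan_map_prodMap_eq {X ι : Type*} [MeasurableSpace X]
    [MeasurableSpace ι] [Countable ι] [MeasurableSingletonClass ι] {σ τ : Measure X} {q : X → ι}
    (hq : Measurable q) (γ : Measure (ι × ι)) [IsFiniteMeasure γ]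
    (hσ : σ.map q = γ.map Prod.fst) (hτ : τ.map q = γ.map Prod.snd) :
    ∃ π : Measure (X × X), π.map Prod.fst = σ ∧ π.map Prod.snd = τ ∧
      π.map (Prod.map q q) = γ := by
  have hs : ∀ i : ι, MeasurableSet ({i} : Set ι) := measurableSet_singleton
  have hσi : ∀ i, σ (q ⁻¹' {i}) = γ (Prod.fst ⁻¹' {i}) := fun i => by
    rw [← Measure.map_apply hq (hs i), hσ, Measure.map_apply measurable_fst (hs i)]
  have hτi : ∀ i, τ (q ⁻¹' {i}) = γ (Prod.snd ⁻¹' {i}) := fun i => by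
    rw [← Measure.map_apply hq (hs i), hτ, Measure.map_apply measurable_snd (hs i)]
  have hσf : ∀ i, σ (q ⁻¹' {i}) ≠ ∞ := fun i => hσi i ▸ measure_ne_top _ _
  have hτf : ∀ i, τ (q ⁻¹' {i}) ≠ ∞ := fun i => hτi i ▸ measure_ne_top _ _
  -- a cell that `γ` charges has positive mass, so conditioning on it gives a probability measure
  have hσ0 : ∀ z, γ {z} ≠ 0 → σ (q ⁻¹' {z.1}) ≠ 0 := fun z hz h0 =>
    hz (measure_mono_null (by simp) (hσi z.1 ▸ h0))
  have hτ0 : ∀ z, γ {z} ≠ 0 → τ (q ⁻¹' {z.2}) ≠ 0 := fun z hz h0 =>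
    hz (measure_mono_null (by simp) (hτi z.2 ▸ h0))
  set cσ := fun i => ProbabilityTheory.cond σ (q ⁻¹' {i}) with hcσ
  set cτ := fun i => ProbabilityTheory.cond τ (q ⁻¹' {i}) with hcτ
  have hcσ1 : ∀ z, γ {z} ≠ 0 → cσ z.1 (q ⁻¹' {z.1}) = 1 := fun z hz =>
    ProbabilityTheory.cond_apply_self (hσ0 z hz) (hσf _)
  have hcτ1 : ∀ z, γ {z} ≠ 0 → cτ z.2 (q ⁻¹' {z.2}) = 1 := fun z hz =>
    ProbabilityTheory.cond_apply_self (hτ0 z hz) (hτf _)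
  have happ : ∀ A B : Set X, MeasurableSet A → MeasurableSet B →
      Measure.sum (fun z : ι × ι => γ {z} • (cσ z.1).prod (cτ z.2)) (A ×ˢ B) =
        ∑' z, γ {z} * (cσ z.1 A * cτ z.2 B) := fun A B hA hB => by
    rw [Measure.sum_apply _ (hA.prod hB)]
    simp [Measure.prod_prod]
  have huniv : ∀ c : Measure X, [IsZeroOrProbabilityMeasure c] → ∀ s, c s = 1 → c Set.univ = 1 :=
    fun c _ s h => le_antisymm prob_le_one (h ▸ measure_mono (Set.subset_univ s))
  refine ⟨Measure.sum fun z : ι × ι => γ {z} • (cσ z.1).prod (cτ z.2), ?_, ?_, ?_⟩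
  · ext A hA
    rw [Measure.map_apply measurable_fst hA, ← Set.prod_univ, happ _ _ hA MeasurableSet.univ,
      ← lintegral_cond_apply σ hq hσf A, hσ,
      lintegral_map (measurable_of_countable _) measurable_fst, lintegral_countable']
    refine tsum_congr fun z => ?_
    rcases eq_or_ne (γ {z}) 0 with h0 | h0
    · simp [h0]
    · rw [huniv _ _ (hcτ1 z h0), mul_one, mul_comm]
  · ext A hA
    rw [Measure.map_apply measurable_snd hA, ← Set.univ_prod, happ _ _ MeasurableSet.univ hA,
      ← lintegral_cond_apply τ hq hτf A, hτ,
      lintegral_map (measurable_of_countable _) measurable_snd, lintegral_countable']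
    refine tsum_congr fun z => ?_
    rcases eq_or_ne (γ {z}) 0 with h0 | h0
    · simp [h0]
    · rw [huniv _ _ (hcσ1 z h0), one_mul, mul_comm]
  · refine Measure.ext_iff_singleton.2 fun w => ?_
    have hpre : Prod.map q q ⁻¹' {w} = (q ⁻¹' {w.1}) ×ˢ (q ⁻¹' {w.2}) := by
      ext x; simp [Prod.ext_iff]
    rw [Measure.map_apply (hq.prodMap hq) (measurableSet_singleton w), hpre,
      happ _ _ (hq (hs _)) (hq (hs _)), tsum_eq_single w]
    · rcases eq_or_ne (γ {w}) 0 with h0 | h0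
      · simp [h0]
      · rw [hcσ1 w h0, hcτ1 w h0, mul_one, mul_one]
    · intro z hzw
      have hdisj : ∀ {i j : ι}, i ≠ j → q ⁻¹' {i} ∩ q ⁻¹' {j} = ∅ := fun h =>
        (Set.disjoint_singleton.2 h).preimage q |>.inter_eq
      rcases not_and_or.1 (fun h : z.1 = w.1 ∧ z.2 = w.2 => hzw (Prod.ext h.1 h.2)) with h | h
      · simp [hcσ, ProbabilityTheory.cond_apply (hq (hs _)), hdisj h]
      · simp [hcτ, ProbabilityTheory.cond_apply (hq (hs _)), hdisj h]

/-- Marginals may be rearranged inside the cells of a partition into sets of diameter at most `d`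
at a price of `2 d` per unit of mass: the supremum of the distance over a product of cells depends
on the plan only through the measure it induces on pairs of cells. -/
theorem exists_plan_cost_le_add {X ι : Type*} [PseudoEMetricSpace X] [MeasurableSpace X]
    [OpensMeasurableSpace X] [SecondCountableTopology X]
    [MeasurableSpace ι] [Countable ι] [MeasurableSingletonClass ι] {q : X → ι}
    (hq : Measurable q) {d : ℝ≥0∞} (hd : ∀ x y, q x = q y → edist x y ≤ d) {p : ℝ} (hp : 1 ≤ p)
    (π : Measure (X × X)) [IsFiniteMeasure π] {σ τ : Measure X}
    (hσ : σ.map q = (π.map Prod.fst).map q) (hτ : τ.map q = (π.map Prod.snd).map q) :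
    ∃ π' : Measure (X × X), π'.map Prod.fst = σ ∧ π'.map Prod.snd = τ ∧
      (∫⁻ z, edist z.1 z.2 ^ p ∂π') ^ (1 / p) ≤
        (∫⁻ z, edist z.1 z.2 ^ p ∂π) ^ (1 / p) + 2 * d * π Set.univ ^ (1 / p) := by
  have hp0 : 0 < p := by linarith
  have hqq : Measurable (Prod.map q q) := hq.prodMap hq
  obtain ⟨π', h1, h2, h3⟩ := exists_plan_map_prodMap_eq (σ := σ) (τ := τ) hq
    (π.map (Prod.map q q))
    (by rw [hσ, Measure.map_map hq measurable_fst, Measure.map_map measurable_fst hqq]; rfl)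
    (by rw [hτ, Measure.map_map hq measurable_snd, Measure.map_map measurable_snd hqq]; rfl)
  refine ⟨π', h1, h2, ?_⟩
  set D : ι × ι → ℝ≥0∞ := fun w => ⨆ (z : X × X) (_ : Prod.map q q z = w), edist z.1 z.2 with hD
  have hle : ∀ z : X × X, edist z.1 z.2 ≤ D (Prod.map q q z) := fun z =>
    le_iSup₂ (f := fun (z' : X × X) (_ : Prod.map q q z' = Prod.map q q z) =>
      edist z'.1 z'.2) z rfl
  have hge : ∀ z : X × X, D (Prod.map q q z) ≤ edist z.1 z.2 + 2 * d := fun z => by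
    refine iSup₂_le fun z' hz' => ?_
    have e1 : q z'.1 = q z.1 := congrArg Prod.fst hz'
    have e2 : q z'.2 = q z.2 := congrArg Prod.snd hz'
    calc edist z'.1 z'.2 ≤ edist z'.1 z.1 + edist z.1 z.2 + edist z.2 z'.2 :=
          edist_triangle4 _ _ _ _
      _ ≤ d + edist z.1 z.2 + d := by gcongr <;> exact hd _ _ (by simp [e1, e2])
      _ = edist z.1 z.2 + 2 * d := by ring
  have hDm : Measurable fun w => D w ^ p := measurable_of_countable _
  calc (∫⁻ z, edist z.1 z.2 ^ p ∂π') ^ (1 / p)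
      ≤ (∫⁻ z, D (Prod.map q q z) ^ p ∂π') ^ (1 / p) := by
        gcongr with z; exact hle z
    _ = (∫⁻ z, D (Prod.map q q z) ^ p ∂π) ^ (1 / p) := by
        rw [← lintegral_map hDm hqq, h3, lintegral_map hDm hqq]
    _ ≤ (∫⁻ z, ((fun z => edist z.1 z.2 : X × X → ℝ≥0∞) +
          (fun _ => 2 * d : X × X → ℝ≥0∞)) z ^ p ∂π) ^ (1 / p) := by
        gcongr with z; exact hge z
    _ ≤ (∫⁻ z, edist z.1 z.2 ^ p ∂π) ^ (1 / p) + (∫⁻ _, (2 * d) ^ p ∂π) ^ (1 / p) :=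
        ENNReal.lintegral_Lp_add_le measurable_edist.aemeasurable aemeasurable_const hp
    _ = _ := by
        rw [lintegral_const, ENNReal.mul_rpow_of_nonneg _ _ (by positivity), ← ENNReal.rpow_mul,
          mul_one_div_cancel hp0.ne', ENNReal.rpow_one]

/-! ### The energy over a reference measure and its stability -/

/-- The least cost of a plan whose first marginal is `μ` and whose second marginal fits into the
room that `μ` leaves below the reference measure `V`. -/
noncomputable def planEnergy {X : Type*} [PseudoEMetricSpace X] [MeasurableSpace X]
    (p : ℝ) (V μ : Measure X) : ℝ≥0∞ :=
  ⨅ (π : Measure (X × X)) (_ : π.map Prod.fst = μ) (_ : μ + π.map Prod.snd ≤ V),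
    (∫⁻ z, edist z.1 z.2 ^ p ∂π) ^ (1 / p)

theorem map_fst_univ {X Y : Type*} [MeasurableSpace X] [MeasurableSpace Y]
    (π : Measure (X × Y)) : π.map Prod.fst Set.univ = π Set.univ := by
  rw [Measure.map_apply measurable_fst MeasurableSet.univ, Set.preimage_univ]

theorem map_snd_univ {X Y : Type*} [MeasurableSpace X] [MeasurableSpace Y]
    (π : Measure (X × Y)) : π.map Prod.snd Set.univ = π Set.univ := by
  rw [Measure.map_apply measurable_snd MeasurableSet.univ, Set.preimage_univ]

theorem isFiniteMeasure_of_map_fst {X Y : Type*} [MeasurableSpace X] [MeasurableSpace Y]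
    {π : Measure (X × Y)} {μ : Measure X} [IsFiniteMeasure μ] (h : π.map Prod.fst = μ) :
    IsFiniteMeasure π :=
  ⟨by rw [← map_fst_univ, h]; exact measure_lt_top _ _⟩

section

variable {X ι : Type*} [PseudoEMetricSpace X] [MeasurableSpace X]
    [OpensMeasurableSpace X] [SecondCountableTopology X]
    [MeasurableSpace ι] [Countable ι] [MeasurableSingletonClass ι]

/-- If every cell has enough room in `κ` for the mass that `σ` has there, then `σ` can be moved
into `κ` without leaving the cells. -/
theorem exists_plan_within_cells {q : X → ι} (hq : Measurable q) {d : ℝ≥0∞}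
    (hd : ∀ x y, q x = q y → edist x y ≤ d) {p : ℝ} (hp : 1 ≤ p) (κ σ : Measure X)
    [IsFiniteMeasure σ] (hκ : ∀ i, κ (q ⁻¹' {i}) ≠ ∞)
    (h : ∀ i, σ (q ⁻¹' {i}) ≤ κ (q ⁻¹' {i})) :
    ∃ π : Measure (X × X), π.map Prod.fst = σ ∧ π.map Prod.snd ≤ κ ∧
      (∫⁻ z, edist z.1 z.2 ^ p ∂π) ^ (1 / p) ≤ 2 * d * σ Set.univ ^ (1 / p) := by
  obtain ⟨τ, hτκ, hτ⟩ := exists_le_preimage_singleton_eq κ hq hκ h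
  -- start from the diagonal plan, which costs nothing
  have hdiag : Measurable fun x : X => (x, x) := measurable_id.prodMk measurable_id
  have h1 : (σ.map fun x => (x, x)).map Prod.fst = σ := by
    rw [Measure.map_map measurable_fst hdiag]; exact Measure.map_id
  have h2 : (σ.map fun x => (x, x)).map Prod.snd = σ := by
    rw [Measure.map_map measurable_snd hdiag]; exact Measure.map_id
  have hfin : IsFiniteMeasure (σ.map fun x : X => (x, x)) := isFiniteMeasure_of_map_fst h1
  obtain ⟨π, hπ1, hπ2, hc⟩ := exists_plan_cost_le_add hq hd hp (σ.map fun x => (x, x))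
    (σ := σ) (τ := τ) (by rw [h1]) (by rw [h2, map_eq_map_of_preimage_singleton hq hq hτ])
  have hp0 : 0 < p := by linarith
  refine ⟨π, hπ1, hπ2 ▸ hτκ, hc.trans ?_⟩
  rw [lintegral_map (by fun_prop) hdiag, ← map_fst_univ (σ.map fun x => (x, x)), h1]
  simp [hp0]

theorem planEnergy_ne_top {V σ : Measure X} [IsFiniteMeasure σ] (hσ : σ ≤ V)
    {q : X → ι} (hq : Measurable q) {d : ℝ≥0∞} (hd : ∀ x y, q x = q y → edist x y ≤ d)
    (hd_top : d ≠ ∞) {p : ℝ} (hp : 1 ≤ p) (hV : ∀ i, V (q ⁻¹' {i}) ≠ ∞)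
    (hroom : ∀ i, 2 * σ Set.univ ≤ V (q ⁻¹' {i})) :
    planEnergy p V σ ≠ ∞ := by
  have hκ : ∀ A, (V - σ) A + σ A = V A := fun A => by
    conv_rhs => rw [← Measure.sub_add_cancel_of_le hσ]
    rfl
  obtain ⟨π, h1, h2, hc⟩ := exists_plan_within_cells hq hd hp (V - σ) σ
    (fun i => ne_top_of_le_ne_top (hV i) (Measure.sub_le _)) fun i => by
      refine (ENNReal.add_le_add_iff_right (measure_ne_top σ (q ⁻¹' {i}))).1 ?_
      rw [hκ, ← two_mul]
      exact (mul_right_mono (measure_mono (Set.subset_univ _))).trans (hroom i)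
  refine ne_top_of_le_ne_top ?_ ((iInf₂_le_of_le π h1 (iInf_le_of_le ?_ le_rfl)).trans hc)
  · exact ENNReal.mul_ne_top (ENNReal.mul_ne_top (by simp) hd_top)
      (ENNReal.rpow_ne_top_of_nonneg (by positivity) (measure_ne_top _ _))
  · calc σ + π.map Prod.snd ≤ σ + (V - σ) := by gcongr
      _ = V := by rw [add_comm, Measure.sub_add_cancel_of_le hσ]

/-- Stability of the energy. Take a plan for `μ`, cut it down so that in every cell `i` of a fine
partition it takes no more mass than `σ` offers and brings no more mass than `σ` leaves room for.
This loses at most twice the total excess of `σ` over `μ`. What is left of the plan is transferred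
to `σ` at the price of the diameter of a fine cell, and the part of `σ` not yet served is moved
within the cells of a coarse partition, which have room for everything. -/
theorem planEnergy_le_add {V μ σ : Measure X} [IsFiniteMeasure μ] [IsFiniteMeasure σ]
    (hσ : σ ≤ V)
    {q : X → ι} (hq : Measurable q) {d : ℝ≥0∞} (hd : ∀ x y, q x = q y → edist x y ≤ d)
    (hV : ∀ i, V (q ⁻¹' {i}) ≠ ∞)
    {q' : X → ι} (hq' : Measurable q') {D : ℝ≥0∞} (hD : ∀ x y, q' x = q' y → edist x y ≤ D)
    (hV' : ∀ i, V (q' ⁻¹' {i}) ≠ ∞) (hroom : ∀ i, 2 * σ Set.univ ≤ V (q' ⁻¹' {i}))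
    {p : ℝ} (hp : 1 ≤ p) :
    planEnergy p V σ ≤ planEnergy p V μ + (2 * d * μ Set.univ ^ (1 / p) +
      2 * D * (2 * ∑' i, (σ (q ⁻¹' {i}) - μ (q ⁻¹' {i}))) ^ (1 / p)) := by
  rw [← tsub_le_iff_right]
  refine le_iInf fun π => le_iInf fun hπ1 => le_iInf fun hπ2 => ?_
  rw [tsub_le_iff_right]
  have hp' : 0 ≤ 1 / p := by positivity
  have hp1 : 1 / p ≤ 1 := by rw [div_le_one (by linarith)]; exact hp
  have : IsFiniteMeasure π := isFiniteMeasure_of_map_fst hπ1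
  have hs : ∀ i : ι, MeasurableSet ({i} : Set ι) := measurableSet_singleton
  have hqf : Measurable fun z : X × X => q z.1 := hq.comp measurable_fst
  have hqs : Measurable fun z : X × X => q z.2 := hq.comp measurable_snd
  set ε := ∑' i, (σ (q ⁻¹' {i}) - μ (q ⁻¹' {i})) with hε
  set κ := V - σ with hκdef
  have hκV : κ + σ = V := Measure.sub_add_cancel_of_le hσ
  have hκ : ∀ A, κ A + σ A = V A := fun A => by rw [← hκV]; rfl
  have hκle : κ ≤ V := Measure.sub_le
  have hκfin : ∀ i, κ (q ⁻¹' {i}) ≠ ∞ := fun i => ne_top_of_le_ne_top (hV i) (hκle _)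
  have hπμ : ∀ i, π ((fun z : X × X => q z.1) ⁻¹' {i}) = μ (q ⁻¹' {i}) := fun i => by
    rw [← hπ1, Measure.map_apply measurable_fst (hq (hs i))]; rfl
  have hπV : ∀ i, π ((fun z : X × X => q z.2) ⁻¹' {i}) + μ (q ⁻¹' {i}) ≤ V (q ⁻¹' {i}) :=
    fun i => by
      refine le_trans (le_of_eq ?_) (hπ2 (q ⁻¹' {i}))
      rw [Measure.add_apply, Measure.map_apply measurable_snd (hq (hs i)), add_comm]; rfl
  -- cut the plan down to what `σ` offers, then to what `σ` leaves room for
  obtain ⟨π₁, hπ₁, hm1⟩ := exists_le_preimage_singleton_eq π hqf (fun i => measure_ne_top _ _)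
    (b := fun i => min (μ (q ⁻¹' {i})) (σ (q ⁻¹' {i})))
    fun i => (min_le_left _ _).trans (hπμ i).ge
  have : IsFiniteMeasure π₁ := isFiniteMeasure_of_le π hπ₁
  obtain ⟨π₂, hπ₂, hm2⟩ := exists_le_preimage_singleton_eq π₁ hqs (fun i => measure_ne_top _ _)
    (b := fun i => min (π₁ ((fun z : X × X => q z.2) ⁻¹' {i})) (κ (q ⁻¹' {i})))
    fun i => min_le_left _ _
  have : IsFiniteMeasure π₂ := isFiniteMeasure_of_le π₁ hπ₂
  have htot : ∀ {Y : Type _} [MeasurableSpace Y] (ν : Measure Y) {g : Y → ι}, Measurable g →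
      ∑' i, ν (g ⁻¹' {i}) = ν Set.univ := fun ν g hg => by
    simpa using tsum_measure_preimage_singleton_inter ν hg Set.univ
  have hloss1 : σ Set.univ ≤ π₁ Set.univ + ε := by
    rw [← htot σ hq, ← htot π₁ hqf, hε, ← ENNReal.tsum_add]
    refine ENNReal.tsum_le_tsum fun i => ?_
    rw [hm1]
    rcases le_total (μ (q ⁻¹' {i})) (σ (q ⁻¹' {i})) with h | h
    · rw [min_eq_left h, add_tsub_cancel_of_le h]
    · rw [min_eq_right h]; exact le_self_add
  have hloss2 : π₁ Set.univ ≤ π₂ Set.univ + ε := by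
    rw [← htot π₁ hqs, ← htot π₂ hqs, hε, ← ENNReal.tsum_add]
    refine ENNReal.tsum_le_tsum fun i => ?_
    rw [hm2]
    have h1 : π₁ ((fun z : X × X => q z.2) ⁻¹' {i}) ≤
        κ (q ⁻¹' {i}) + (σ (q ⁻¹' {i}) - μ (q ⁻¹' {i})) := by
      refine le_trans (ENNReal.le_sub_of_add_le_right (measure_ne_top μ (q ⁻¹' {i})) ?_)
        add_tsub_le_assoc
      rw [hκ]
      exact (add_le_add_left (hπ₁ _) _).trans (hπV i)
    rcases le_total (π₁ ((fun z : X × X => q z.2) ⁻¹' {i})) (κ (q ⁻¹' {i})) with h | h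
    · rw [min_eq_left h]; exact le_self_add
    · rw [min_eq_right h]; exact h1
  -- serve as much of `σ` as the remaining plan covers
  obtain ⟨σ₁, hσ₁, hσm⟩ := exists_le_preimage_singleton_eq σ hq (fun i => measure_ne_top _ _)
    (b := fun i => π₂ ((fun z : X × X => q z.1) ⁻¹' {i}))
    fun i => (hπ₂ _).trans ((hm1 i).le.trans (min_le_right _ _))
  obtain ⟨τ₁, hτ₁, hτm⟩ := exists_le_preimage_singleton_eq κ hq hκfin
    (b := fun i => π₂ ((fun z : X × X => q z.2) ⁻¹' {i}))
    fun i => (hm2 i).le.trans (min_le_right _ _)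
  have hσ₁u : σ₁ Set.univ = π₂ Set.univ := by
    rw [← htot σ₁ hq, ← htot π₂ hqf]; exact tsum_congr hσm
  have hτ₁u : τ₁ Set.univ = π₂ Set.univ := by
    rw [← htot τ₁ hq, ← htot π₂ hqs]; exact tsum_congr hτm
  have : IsFiniteMeasure σ₁ := isFiniteMeasure_of_le σ hσ₁
  have : IsFiniteMeasure τ₁ := ⟨hτ₁u ▸ measure_lt_top _ _⟩
  obtain ⟨π₃, h31, h32, hc3⟩ := exists_plan_cost_le_add hq hd hp π₂ (σ := σ₁) (τ := τ₁)
    (by rw [Measure.map_map hq measurable_fst]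
        exact map_eq_map_of_preimage_singleton hq hqf hσm)
    (by rw [Measure.map_map hq measurable_snd]
        exact map_eq_map_of_preimage_singleton hq hqs hτm)
  -- move the rest of `σ` within the coarse cells
  have hσ₂ : σ - σ₁ + σ₁ = σ := Measure.sub_add_cancel_of_le hσ₁
  have hκ₂ : κ - τ₁ + τ₁ = κ := Measure.sub_add_cancel_of_le hτ₁
  have hσ₂u : (σ - σ₁) Set.univ + π₂ Set.univ = σ Set.univ := by
    conv_rhs => rw [← hσ₂]
    rw [Measure.add_apply, hσ₁u]
  have hrest : (σ - σ₁) Set.univ ≤ 2 * ε := by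
    refine (ENNReal.add_le_add_iff_right (measure_ne_top π₂ Set.univ)).1 ?_
    rw [hσ₂u]
    calc σ Set.univ ≤ π₁ Set.univ + ε := hloss1
      _ ≤ π₂ Set.univ + ε + ε := by gcongr
      _ = 2 * ε + π₂ Set.univ := by ring
  obtain ⟨π₄, h41, h42, hc4⟩ := exists_plan_within_cells hq' hD hp (κ - τ₁) (σ - σ₁)
    (fun i => ne_top_of_le_ne_top (hV' i) ((Measure.sub_le (μ := κ) _).trans (hκle _)))
    fun i => by
      refine (ENNReal.add_le_add_iff_right (measure_ne_top (τ₁ + σ) (q' ⁻¹' {i}))).1 ?_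
      calc (σ - σ₁) (q' ⁻¹' {i}) + (τ₁ + σ) (q' ⁻¹' {i})
          ≤ (σ - σ₁) Set.univ + (τ₁ + σ) Set.univ := by
            gcongr <;> exact Set.subset_univ _
        _ = 2 * σ Set.univ := by
            rw [Measure.add_apply, hτ₁u, ← add_assoc, hσ₂u, two_mul]
        _ ≤ V (q' ⁻¹' {i}) := hroom i
        _ = (κ - τ₁ + τ₁ + σ) (q' ⁻¹' {i}) := by rw [hκ₂, hκV]
        _ = _ := by simp only [Measure.add_apply, add_assoc]
  refine (iInf₂_le_of_le (π₃ + π₄) ?_ (iInf_le_of_le ?_ le_rfl)).trans ?_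
  · rw [Measure.map_add _ _ measurable_fst, h31, h41, add_comm, hσ₂]
  · rw [Measure.map_add _ _ measurable_snd, h32]
    calc σ + (τ₁ + π₄.map Prod.snd) ≤ σ + (τ₁ + (κ - τ₁)) := by gcongr
      _ = V := by rw [add_comm τ₁, hκ₂, add_comm, hκV]
  · rw [lintegral_add_measure]
    refine (ENNReal.rpow_add_le_add_rpow _ _ hp' hp1).trans ?_
    rw [← add_assoc]
    have h2 : π₂ ≤ π := hπ₂.trans hπ₁
    refine add_le_add (hc3.trans (add_le_add ?_ ?_)) (hc4.trans ?_)
    · exact ENNReal.rpow_le_rpow (lintegral_mono' h2 le_rfl) hp'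
    · refine mul_right_mono (ENNReal.rpow_le_rpow ((h2 _).trans ?_) hp')
      rw [← map_fst_univ π, hπ1]
    · exact mul_right_mono (ENNReal.rpow_le_rpow hrest hp')

end

/-! ### Cubes -/

/-- The index of the half-open cube of side `δ` of the standard grid that contains a point. -/
noncomputable def cubeIndex {N : ℕ} (δ : ℝ) (x : EuclideanSpace ℝ (Fin N)) : Fin N → ℤ :=
  fun k => ⌊x k / δ⌋

theorem measurable_cubeIndex {N : ℕ} (δ : ℝ) : Measurable (cubeIndex (N := N) δ) :=
  measurable_pi_lambda _ fun k => Int.measurable_floor.comp (by fun_prop)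

theorem edist_le_of_cubeIndex_eq {N : ℕ} {δ : ℝ} (hδ : 0 < δ) (x y : EuclideanSpace ℝ (Fin N))
    (h : cubeIndex δ x = cubeIndex δ y) : edist x y ≤ ENNReal.ofReal (N * δ) := by
  rw [edist_dist]
  refine ENNReal.ofReal_le_ofReal ?_
  have hk : ∀ k, dist (x k) (y k) ≤ δ := fun k => by
    have := Int.abs_sub_lt_one_of_floor_eq_floor (congrFun h k)
    rw [← sub_div, abs_div, abs_of_pos hδ, div_lt_one hδ] at this
    exact this.le
  rw [EuclideanSpace.dist_eq]
  refine Real.sqrt_le_iff.2 ⟨by positivity, ?_⟩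
  calc ∑ k, dist (x k) (y k) ^ 2 ≤ ∑ _k : Fin N, δ ^ 2 :=
        Finset.sum_le_sum fun k _ => pow_le_pow_left₀ dist_nonneg (hk k) 2
    _ = N * δ ^ 2 := by simp
    _ ≤ (N * N) * δ ^ 2 := by
        gcongr
        exact_mod_cast Nat.le_mul_self N
    _ = (N * δ) ^ 2 := by ring

theorem volume_cubeIndex_preimage {N : ℕ} {δ : ℝ} (hδ : 0 < δ) (i : Fin N → ℤ) :
    volume (cubeIndex (N := N) δ ⁻¹' {i}) = ENNReal.ofReal δ ^ N := by
  have hpre : cubeIndex (N := N) δ ⁻¹' {i} = (MeasurableEquiv.toLp 2 (Fin N → ℝ)).symm ⁻¹'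
      (Set.univ.pi fun k => Set.Ico (i k * δ) ((i k + 1) * δ)) := by
    ext x
    simp only [cubeIndex, Set.mem_preimage, Set.mem_singleton_iff, funext_iff, Int.floor_eq_iff,
      Set.mem_pi, Set.mem_univ, true_imp_iff, Set.mem_Ico, le_div_iff₀ hδ, div_lt_iff₀ hδ]
    rfl
  rw [hpre, (EuclideanSpace.volume_preserving_symm_measurableEquiv_toLp (Fin N)).measure_preimage
    (MeasurableSet.univ_pi fun _ => measurableSet_Ico).nullMeasurableSet, volume_pi_pi]
  simp only [Real.volume_Ico]
  simp [← sub_mul]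

theorem volume_cubeIndex_preimage_ne_top {N : ℕ} {δ : ℝ} (hδ : 0 < δ) (i : Fin N → ℤ) :
    volume (cubeIndex (N := N) δ ⁻¹' {i}) ≠ ∞ := by
  rw [volume_cubeIndex_preimage hδ]
  exact ENNReal.pow_ne_top ENNReal.ofReal_ne_top

theorem exists_le_volume_cubeIndex_preimage {N : ℕ} (hN : 1 ≤ N) {c : ℝ≥0∞} (hc : c ≠ ∞) :
    ∃ L : ℝ, 0 < L ∧ ∀ i, c ≤ volume (cubeIndex (N := N) L ⁻¹' {i}) := by
  have hL : 1 ≤ max 1 c.toReal := le_max_left _ _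
  refine ⟨max 1 c.toReal, by positivity, fun i => ?_⟩
  rw [volume_cubeIndex_preimage (by positivity), ← ENNReal.ofReal_pow (by positivity)]
  refine ENNReal.le_ofReal_iff_toReal_le hc (by positivity) |>.2 ((le_max_right 1 _).trans ?_)
  exact le_self_pow₀ hL (by omega)

/-! ### Subsets of prescribed volume -/

/-- Lebesgue measure takes every intermediate value on the subsets of a set: intersect with balls
of growing radius. -/
theorem exists_subset_volume_eq {N : ℕ} (hN : 1 ≤ N) {S : Set (EuclideanSpace ℝ (Fin N))}
    (hS : MeasurableSet S) (hfin : volume S ≠ ∞) {c : ℝ≥0∞} (hc : c ≤ volume S) :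
    ∃ F ⊆ S, MeasurableSet F ∧ volume F = c := by
  have : Nonempty (Fin N) := ⟨⟨0, hN⟩⟩
  rcases hc.eq_or_lt with rfl | hc
  · exact ⟨S, subset_rfl, hS, rfl⟩
  set g : ℝ → ℝ := fun t =>
    ∫ x in S, (Metric.closedBall (0 : EuclideanSpace ℝ (Fin N)) t).indicator (fun _ => (1 : ℝ)) x
    with hg
  have hgeq : ∀ t, g t = volume.real (S ∩ Metric.closedBall 0 t) := fun t => by
    rw [hg]
    simp only
    rw [integral_indicator_const _ measurableSet_closedBall, smul_eq_mul, mul_one,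
      measureReal_restrict_apply measurableSet_closedBall, Set.inter_comm]
  have hcont : Continuous g := by
    refine continuous_iff_continuousAt.2 fun t₀ => ?_
    have : IsFiniteMeasure (volume.restrict S) := ⟨by simpa using hfin.lt_top⟩
    refine continuousAt_of_dominated (bound := fun _ => 1) (Eventually.of_forall fun t =>
      (stronglyMeasurable_const.indicator measurableSet_closedBall).aestronglyMeasurable)
      (Eventually.of_forall fun t => Eventually.of_forall fun x => ?_) (integrable_const _) ?_
    · exact (norm_indicator_le_norm_self _ _).trans (by simp)
    · have hsph : ∀ᵐ x ∂(volume.restrict S), x ∉ Metric.sphere (0 : EuclideanSpace ℝ (Fin N)) t₀ :=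
        ae_restrict_of_ae (measure_eq_zero_iff_ae_notMem.1 (Measure.addHaar_sphere _ _ _))
      filter_upwards [hsph] with x hx
      rw [mem_sphere_zero_iff_norm] at hx
      rcases lt_or_gt_of_ne hx with h | h
      · refine continuousAt_const.congr (f := fun _ => (1 : ℝ)) ?_
        filter_upwards [lt_mem_nhds h] with t ht
        rw [Set.indicator_of_mem (mem_closedBall_zero_iff.2 ht.le)]
      · refine continuousAt_const.congr (f := fun _ => (0 : ℝ)) ?_
        filter_upwards [gt_mem_nhds h] with t ht
        rw [Set.indicator_of_notMem fun h' => ht.not_ge (mem_closedBall_zero_iff.1 h')]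
  have hneg : g (-1) = 0 := by
    rw [hgeq, Metric.closedBall_eq_empty.2 (by norm_num), Set.inter_empty, measureReal_empty]
  -- some ball already captures more than `c`
  obtain ⟨n, hn⟩ : ∃ n : ℕ, c < volume (S ∩ Metric.closedBall 0 n) := by
    have hmono : Monotone fun n : ℕ => S ∩ Metric.closedBall (0 : EuclideanSpace ℝ (Fin N)) n :=
      fun a b hab => Set.inter_subset_inter_right _
        (Metric.closedBall_subset_closedBall (by exact_mod_cast hab))
    have := tendsto_measure_iUnion_atTop (μ := volume) hmono
    rw [← Set.inter_iUnion, Metric.iUnion_closedBall_nat, Set.inter_univ] at this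
    exact (this.eventually (lt_mem_nhds hc)).exists
  have hcn : c.toReal ≤ g n := by
    rw [hgeq]
    exact ENNReal.toReal_mono (ne_top_of_le_ne_top hfin (measure_mono Set.inter_subset_left)) hn.le
  obtain ⟨t, -, ht⟩ := intermediate_value_Icc (by linarith [n.cast_nonneg (α := ℝ)] : (-1 : ℝ) ≤ n)
    hcont.continuousOn ⟨hneg.trans_le ENNReal.toReal_nonneg, hcn⟩
  refine ⟨S ∩ Metric.closedBall 0 t, Set.inter_subset_left,
    hS.inter measurableSet_closedBall, ?_⟩
  rw [hgeq] at ht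
  exact (ENNReal.toReal_eq_toReal_iff' (ne_top_of_le_ne_top hfin (measure_mono
    Set.inter_subset_left)) hc.ne_top).1 ht

theorem exists_subset_volume_inter_cube_eq {N : ℕ} (hN : 1 ≤ N) {δ : ℝ} (hδ : 0 < δ)
    {A : Set (EuclideanSpace ℝ (Fin N))} (hA : MeasurableSet A) {b : (Fin N → ℤ) → ℝ≥0∞}
    (hb : ∀ i, b i ≤ volume.restrict A (cubeIndex δ ⁻¹' {i})) :
    ∃ F ⊆ A, MeasurableSet F ∧ ∀ i, volume.restrict F (cubeIndex δ ⁻¹' {i}) = b i := by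
  have hQ : ∀ i, MeasurableSet (cubeIndex (N := N) δ ⁻¹' {i}) := fun i =>
    measurable_cubeIndex δ (measurableSet_singleton i)
  choose F hFS hFm hFv using fun i => exists_subset_volume_eq hN ((hQ i).inter hA)
    (ne_top_of_le_ne_top (volume_cubeIndex_preimage_ne_top hδ i) (measure_mono
      Set.inter_subset_left)) ((hb i).trans_eq (Measure.restrict_apply (hQ i)))
  refine ⟨⋃ i, F i, Set.iUnion_subset fun i => (hFS i).trans Set.inter_subset_right,
    MeasurableSet.iUnion hFm, fun i => ?_⟩
  rw [Measure.restrict_apply (hQ i), ← hFv i]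
  congr 1
  refine Set.Subset.antisymm ?_ fun x hx => ⟨(hFS i hx).1, Set.mem_iUnion.2 ⟨i, hx⟩⟩
  rintro x ⟨hx, hx'⟩
  obtain ⟨j, hj⟩ := Set.mem_iUnion.1 hx'
  obtain rfl : j = i := (hFS j hj).1.symm.trans hx
  exact hj

/-! ### The energies in terms of plans -/

theorem wassersteinDist_le_of_plan {X : Type*} [PseudoEMetricSpace X] [MeasurableSpace X] {p : ℝ}
    (hp : 1 ≤ p) {μ ν : Measure X} {π : Measure (X × X)} (h1 : π.map Prod.fst = μ)
    (h2 : π.map Prod.snd = ν) :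
    wassersteinDist p μ ν ≤ (∫⁻ z, edist z.1 z.2 ^ p ∂π) ^ (1 / p) :=
  ENNReal.rpow_le_rpow (iInf₂_le_of_le π h1 (iInf_le _ h2)) (by positivity)

theorem le_wassersteinDist {X : Type*} [PseudoEMetricSpace X] [MeasurableSpace X] {p : ℝ}
    (hp : 1 ≤ p) {μ ν : Measure X} {a : ℝ≥0∞}
    (h : ∀ π : Measure (X × X), π.map Prod.fst = μ → π.map Prod.snd = ν →
      a ≤ (∫⁻ z, edist z.1 z.2 ^ p ∂π) ^ (1 / p)) :
    a ≤ wassersteinDist p μ ν := by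
  have hp0 : 0 < p := by linarith
  simp only [one_div, ENNReal.le_rpow_inv_iff hp0] at h
  rw [wassersteinDist, one_div, ENNReal.le_rpow_inv_iff hp0]
  exact le_iInf fun π => le_iInf fun h1 => le_iInf fun h2 => h π h1 h2

theorem planEnergy_le_wassersteinDist {X : Type*} [PseudoEMetricSpace X] [MeasurableSpace X]
    {p : ℝ} (hp : 1 ≤ p) {V μ ν : Measure X} (h : μ + ν ≤ V) :
    planEnergy p V μ ≤ wassersteinDist p μ ν :=
  le_wassersteinDist hp fun π h1 h2 => iInf₂_le_of_le π h1 (iInf_le _ (h2 ▸ h))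

variable {N : ℕ}

theorem aemeasurable_ofReal_of_integrable {ρ : EuclideanSpace ℝ (Fin N) → ℝ}
    (hρ : Integrable ρ) : AEMeasurable fun x => ENNReal.ofReal (ρ x) :=
  hρ.aestronglyMeasurable.aemeasurable.ennreal_ofReal

theorem densityMeasure_univ {ρ : EuclideanSpace ℝ (Fin N) → ℝ} (hρ : Integrable ρ)
    (h0 : ∀ᵐ x, 0 ≤ ρ x) : densityMeasure ρ Set.univ = ENNReal.ofReal (∫ x, ρ x) := by
  rw [densityMeasure, withDensity_apply _ MeasurableSet.univ, Measure.restrict_univ,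
    ofReal_integral_eq_lintegral_ofReal hρ h0]

theorem isFiniteMeasure_densityMeasure {ρ : EuclideanSpace ℝ (Fin N) → ℝ} (hρ : Integrable ρ)
    (h0 : ∀ᵐ x, 0 ≤ ρ x) : IsFiniteMeasure (densityMeasure ρ) :=
  ⟨by rw [densityMeasure_univ hρ h0]; exact ENNReal.ofReal_lt_top⟩

theorem densityMeasure_congr {ρ ρ' : EuclideanSpace ℝ (Fin N) → ℝ} (h : ρ =ᵐ[volume] ρ') :
    densityMeasure ρ = densityMeasure ρ' :=
  withDensity_congr_ae (h.mono fun x hx => by simp only [hx])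

theorem densityMeasure_indicator {E : Set (EuclideanSpace ℝ (Fin N))} (hE : MeasurableSet E) :
    densityMeasure (E.indicator fun _ => 1) = volume.restrict E := by
  rw [← withDensity_indicator_one hE, densityMeasure]
  congr 1
  ext x
  by_cases hx : x ∈ E <;> simp [hx]

theorem densityMeasure_add_le_volume_iff {ρ ρ' : EuclideanSpace ℝ (Fin N) → ℝ}
    (hρ : Integrable ρ) (h0 : ∀ᵐ x, 0 ≤ ρ x) (hρ' : Integrable ρ') (h0' : ∀ᵐ x, 0 ≤ ρ' x) :
    densityMeasure ρ + densityMeasure ρ' ≤ volume ↔ ∀ᵐ x, ρ x + ρ' x ≤ 1 := by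
  have hm := aemeasurable_ofReal_of_integrable hρ
  have hm' := aemeasurable_ofReal_of_integrable hρ'
  have happ : ∀ s, MeasurableSet s → (densityMeasure ρ + densityMeasure ρ') s =
      ∫⁻ x in s, (ENNReal.ofReal (ρ x) + ENNReal.ofReal (ρ' x)) := fun s hs => by
    rw [Measure.add_apply, densityMeasure, densityMeasure, withDensity_apply _ hs,
      withDensity_apply _ hs, lintegral_add_left' hm.restrict]
  have hae : (∀ᵐ x, ρ x + ρ' x ≤ 1) ↔
      ∀ᵐ x, ENNReal.ofReal (ρ x) + ENNReal.ofReal (ρ' x) ≤ 1 := by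
    constructor <;> intro h <;> filter_upwards [h, h0, h0'] with x hx hx0 hx0'
    · rw [← ENNReal.ofReal_add hx0 hx0']
      exact ENNReal.ofReal_le_one.2 hx
    · rw [← ENNReal.ofReal_add hx0 hx0'] at hx
      exact ENNReal.ofReal_le_one.1 hx
  rw [hae]
  constructor
  · intro h
    refine ae_le_of_forall_setLIntegral_le_of_sigmaFinite₀ (g := fun _ => 1) (hm.add hm')
      fun s hs _ => ?_
    rw [← happ s hs, setLIntegral_one]
    exact h s
  · intro h
    refine Measure.le_iff.2 fun s hs => ?_
    rw [happ s hs, ← setLIntegral_one s]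
    exact lintegral_mono_ae (ae_restrict_of_ae h)

/-- A finite measure below Lebesgue measure has an integrable nonnegative density. -/
theorem exists_densityMeasure_eq {ν : Measure (EuclideanSpace ℝ (Fin N))} [IsFiniteMeasure ν]
    (hν : ν ≤ volume) :
    ∃ ρ : EuclideanSpace ℝ (Fin N) → ℝ, Integrable ρ ∧ (∀ x, 0 ≤ ρ x) ∧ densityMeasure ρ = ν := by
  refine ⟨fun x => (ν.rnDeriv volume x).toReal, Measure.integrable_toReal_rnDeriv,
    fun x => ENNReal.toReal_nonneg, ?_⟩
  rw [densityMeasure]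
  conv_rhs => rw [← Measure.withDensity_rnDeriv_eq ν volume (Measure.absolutelyContinuous_of_le hν)]
  refine withDensity_congr_ae ?_
  filter_upwards [Measure.rnDeriv_lt_top ν volume] with x hx
  exact ENNReal.ofReal_toReal hx.ne

theorem energy_eq_planEnergy {p : ℝ} (hp : 1 ≤ p) {ρ : EuclideanSpace ℝ (Fin N) → ℝ}
    (hρ : Integrable ρ) (h0 : ∀ᵐ x, 0 ≤ ρ x) :
    energy p ρ = planEnergy p volume (densityMeasure ρ) := by
  have := isFiniteMeasure_densityMeasure hρ h0
  refine le_antisymm (le_iInf fun π => le_iInf fun h1 => le_iInf fun h2 => ?_) ?_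
  · have : IsFiniteMeasure π := isFiniteMeasure_of_map_fst h1
    obtain ⟨ρ', hρ', h0', hν⟩ := exists_densityMeasure_eq
      ((Measure.le_add_left le_rfl).trans h2 : π.map Prod.snd ≤ volume)
    have h0'' := Eventually.of_forall (f := ae volume) h0'
    refine iInf₂_le_of_le ρ' hρ' (iInf₂_le_of_le h0'' ?_ (iInf_le_of_le ?_ ?_))
    · exact (densityMeasure_add_le_volume_iff hρ h0 hρ' h0'').1 (hν ▸ h2)
    · have h := (map_snd_univ π).trans (map_fst_univ π).symm
      rw [← hν, h1, densityMeasure_univ hρ' h0'', densityMeasure_univ hρ h0,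
        ENNReal.ofReal_eq_ofReal_iff (integral_nonneg h0') (integral_nonneg_of_ae h0)] at h
      exact h
    · exact wassersteinDist_le_of_plan hp h1 hν.symm
  · exact le_iInf fun ρ' => le_iInf fun hρ' => le_iInf fun h0' => le_iInf fun h1 =>
      le_iInf fun _ => planEnergy_le_wassersteinDist hp
        ((densityMeasure_add_le_volume_iff hρ h0 hρ' h0').2 h1)

/-- Allowing densities instead of sets as competitors does not lower the energy of a set: inside
each cell of a fine grid, the density can be replaced by a set of the same mass. -/
theorem setEnergy_eq_planEnergy (hN : 1 ≤ N) {p : ℝ} (hp : 1 ≤ p)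
    {E : Set (EuclideanSpace ℝ (Fin N))} (hE : MeasurableSet E) (hfin : volume E ≠ ∞) :
    setEnergy p E = planEnergy p volume (volume.restrict E) := by
  have : IsFiniteMeasure (volume.restrict E) := ⟨by simpa using hfin.lt_top⟩
  refine le_antisymm (le_iInf fun π => le_iInf fun h1 => le_iInf fun h2 => ?_) ?_
  · have : IsFiniteMeasure π := isFiniteMeasure_of_map_fst h1
    have key : ∀ δ > 0, setEnergy p E ≤ (∫⁻ z, edist z.1 z.2 ^ p ∂π) ^ (1 / p) +
        2 * ENNReal.ofReal (N * δ) * π Set.univ ^ (1 / p) := fun δ hδ => by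
      have hqm := measurable_cubeIndex (N := N) δ
      have hcompl : π.map Prod.snd ≤ volume.restrict Eᶜ := by
        have h3 := Measure.restrict_add_restrict_compl (μ := volume) hE
        refine Measure.le_iff.2 fun s hs => ?_
        exact (ENNReal.add_le_add_iff_left (measure_ne_top (volume.restrict E) s)).1
          ((h2 s).trans_eq (by rw [← Measure.add_apply, h3]))
      obtain ⟨F, hFE, hFm, hF⟩ := exists_subset_volume_inter_cube_eq hN hδ hE.compl
        (b := fun i => π.map Prod.snd (cubeIndex δ ⁻¹' {i})) fun i => hcompl _
      obtain ⟨π', h1', h2', hc⟩ := exists_plan_cost_le_add hqm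
        (edist_le_of_cubeIndex_eq hδ) hp π (σ := volume.restrict E) (τ := volume.restrict F)
        (by rw [h1]) (map_eq_map_of_preimage_singleton hqm hqm hF)
      refine (iInf₂_le_of_le F hFm (iInf₂_le_of_le ?_ ?_
        (wassersteinDist_le_of_plan hp h1' h2'))).trans hc
      · have h := (map_snd_univ π').trans (map_fst_univ π').symm
        rw [h1', h2'] at h
        simpa using h
      · rw [(disjoint_compl_right.mono_right hFE : Disjoint E F).inter_eq, measure_empty]
    have hlim : Tendsto (fun δ : ℝ => (∫⁻ z, edist z.1 z.2 ^ p ∂π) ^ (1 / p) +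
        2 * ENNReal.ofReal (N * δ) * π Set.univ ^ (1 / p)) (𝓝[>] 0)
        (𝓝 ((∫⁻ z, edist z.1 z.2 ^ p ∂π) ^ (1 / p) +
          2 * ENNReal.ofReal (N * 0) * π Set.univ ^ (1 / p))) := by
      refine tendsto_nhdsWithin_of_tendsto_nhds (tendsto_const_nhds.add ?_)
      refine ENNReal.Tendsto.mul_const (ENNReal.Tendsto.const_mul
        (ENNReal.tendsto_ofReal (tendsto_id.const_mul _)) (Or.inr (by simp))) (Or.inr ?_)
      exact ENNReal.rpow_ne_top_of_nonneg (by positivity) (measure_ne_top _ _)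
    have := ge_of_tendsto hlim (eventually_mem_nhdsWithin.mono fun δ hδ => key δ hδ)
    simpa using this
  · refine le_iInf fun F => le_iInf fun hF => le_iInf fun _ => le_iInf fun h0 =>
      planEnergy_le_wassersteinDist hp ?_
    rw [← Measure.restrict_union₀ h0 hF.nullMeasurableSet]
    exact Measure.restrict_le_self

/-! ### Weak* convergence and cell masses -/

namespace AdmissibleDensity

variable {m : ℝ≥0}

theorem densityMeasure_univ (ρ : AdmissibleDensity N m) :
    densityMeasure ρ.toFun Set.univ = m := by
  rw [WassersteinEnergy.densityMeasure_univ ρ.integrable ρ.nonneg, ρ.integral_eq,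
    ENNReal.ofReal_coe_nnreal]

theorem isFiniteMeasure (ρ : AdmissibleDensity N m) : IsFiniteMeasure (densityMeasure ρ.toFun) :=
  isFiniteMeasure_densityMeasure ρ.integrable ρ.nonneg

theorem densityMeasure_le_volume (ρ : AdmissibleDensity N m) :
    densityMeasure ρ.toFun ≤ volume :=
  (withDensity_mono (ρ.le_one.mono fun _ hx => ENNReal.ofReal_le_one.2 hx)).trans_eq
    withDensity_one

theorem energy_eq {p : ℝ} (hp : 1 ≤ p) (ρ : AdmissibleDensity N m) :
    energy p ρ.toFun = planEnergy p volume (densityMeasure ρ.toFun) :=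
  energy_eq_planEnergy hp ρ.integrable ρ.nonneg

theorem integral_densityMeasure (ρ : AdmissibleDensity N m)
    (f : EuclideanSpace ℝ (Fin N) → ℝ) :
    ∫ x, f x ∂(densityMeasure ρ.toFun) = ∫ x, f x * ρ.toFun x := by
  rw [densityMeasure, integral_withDensity_eq_integral_toReal_smul₀
    (aemeasurable_ofReal_of_integrable ρ.integrable)
    (Eventually.of_forall fun _ => ENNReal.ofReal_lt_top)]
  refine integral_congr_ae (ρ.nonneg.mono fun x hx => ?_)
  simp only [ENNReal.toReal_ofReal hx, smul_eq_mul, mul_comm]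

theorem tendsto_nhds_iff {α : Type*} {l : Filter α} {u : α → AdmissibleDensity N m}
    {ρ : AdmissibleDensity N m} :
    Tendsto u l (𝓝 ρ) ↔ ∀ φ : C₀(EuclideanSpace ℝ (Fin N), ℝ),
      Tendsto (fun a => ∫ x, φ x * (u a).toFun x) l (𝓝 (∫ x, φ x * ρ.toFun x)) := by
  have h : IsInducing fun ρ : AdmissibleDensity N m =>
    fun φ : C₀(EuclideanSpace ℝ (Fin N), ℝ) => ∫ x, φ x * ρ.toFun x := ⟨rfl⟩
  rw [h.tendsto_nhds_iff, tendsto_pi_nhds]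
  rfl

/-- Since the densities are bounded by `1`, weak* convergence also holds against the
characteristic functions of sets of finite measure, which are `L¹` limits of test functions. -/
theorem tendsto_densityMeasure_apply (ρ : AdmissibleDensity N m)
    {Q : Set (EuclideanSpace ℝ (Fin N))} (hQ : MeasurableSet Q) (hfin : volume Q ≠ ∞) :
    Tendsto (fun σ : AdmissibleDensity N m => densityMeasure σ.toFun Q) (𝓝 ρ)
      (𝓝 (densityMeasure ρ.toFun Q)) := by
  have hne : ∀ σ : AdmissibleDensity N m, densityMeasure σ.toFun Q ≠ ∞ := fun σ =>
    have := σ.isFiniteMeasure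
    measure_ne_top _ _
  rw [← ENNReal.tendsto_toReal_iff hne (hne ρ), Metric.tendsto_nhds]
  intro η hη
  have hint : Integrable (Q.indicator fun _ => (1 : ℝ)) :=
    (integrable_indicator_iff hQ).2 (integrableOn_const hfin (by simp))
  obtain ⟨g, hgs, hgle, hgc, hgi⟩ := hint.exists_hasCompactSupport_lintegral_sub_le
    (ε := ENNReal.ofReal (η / 3)) (by simpa using hη)
  let φ : C₀(EuclideanSpace ℝ (Fin N), ℝ) := ⟨⟨g, hgc⟩, hgs.is_zero_at_infty⟩
  have hclose : ∀ σ : AdmissibleDensity N m,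
      dist (densityMeasure σ.toFun Q).toReal (∫ x, φ x * σ.toFun x) ≤ η / 3 := fun σ => by
    have := σ.isFiniteMeasure
    have hle := σ.densityMeasure_le_volume
    have hQi : (densityMeasure σ.toFun Q).toReal =
        ∫ x, Q.indicator (fun _ => (1 : ℝ)) x ∂(densityMeasure σ.toFun) := by
      rw [integral_indicator_const _ hQ, smul_eq_mul, mul_one]; rfl
    have hφg : ∫ x, φ x ∂(densityMeasure σ.toFun) = ∫ x, g x ∂(densityMeasure σ.toFun) := rfl
    rw [← σ.integral_densityMeasure, hφg, hQi, dist_eq_norm,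
      ← integral_sub (hint.mono_measure hle) (hgi.mono_measure hle)]
    refine (norm_integral_le_lintegral_norm _).trans ?_
    refine ENNReal.toReal_le_of_le_ofReal (by positivity) (le_trans ?_ hgle)
    simp only [ofReal_norm]
    exact lintegral_mono' hle le_rfl
  have hφ := Metric.tendsto_nhds.1 (tendsto_nhds_iff.1 (tendsto_id (x := 𝓝 ρ)) φ) (η / 3)
    (by positivity)
  filter_upwards [hφ] with σ hσ
  have h1 := hclose σ
  have h2 := hclose ρ
  have h3 := dist_triangle4_right (densityMeasure σ.toFun Q).toReal
    (densityMeasure ρ.toFun Q).toReal (∫ x, φ x * σ.toFun x) (∫ x, φ x * ρ.toFun x)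
  simp only [id] at hσ
  linarith

/-- The total loss of mass over the cells of a countable partition into sets of finite measure
tends to zero under weak* convergence, by dominated convergence for sums. -/
theorem tendsto_tsum_sub {ι : Type*} [Countable ι] [MeasurableSpace ι]
    [MeasurableSingletonClass ι] {q : EuclideanSpace ℝ (Fin N) → ι} (hq : Measurable q)
    (hfin : ∀ i, volume (q ⁻¹' {i}) ≠ ∞) (ρ : AdmissibleDensity N m) :
    Tendsto (fun σ : AdmissibleDensity N m => ∑' i, (densityMeasure ρ.toFun (q ⁻¹' {i}) -
      densityMeasure σ.toFun (q ⁻¹' {i}))) (𝓝 ρ) (𝓝 0) := by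
  have := ρ.isFiniteMeasure
  have hsum : ∑' i, densityMeasure ρ.toFun (q ⁻¹' {i}) ≠ ∞ := by
    have h := tsum_measure_preimage_singleton_inter (densityMeasure ρ.toFun) hq Set.univ
    simp only [Set.inter_univ] at h
    exact h ▸ measure_ne_top _ _
  have hle : ∀ (σ : AdmissibleDensity N m) i, densityMeasure ρ.toFun (q ⁻¹' {i}) -
      densityMeasure σ.toFun (q ⁻¹' {i}) ≤ densityMeasure ρ.toFun (q ⁻¹' {i}) :=
    fun σ i => tsub_le_self
  have hne : ∀ (σ : AdmissibleDensity N m) i, densityMeasure ρ.toFun (q ⁻¹' {i}) -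
      densityMeasure σ.toFun (q ⁻¹' {i}) ≠ ∞ :=
    fun σ i => ne_top_of_le_ne_top (measure_ne_top _ _) (hle σ i)
  rw [← ENNReal.tendsto_toReal_iff
    (fun σ => ne_top_of_le_ne_top hsum (ENNReal.tsum_le_tsum (hle σ))) ENNReal.zero_ne_top]
  simp only [ENNReal.tsum_toReal_eq (hne _)]
  have h := tendsto_tsum_of_dominated_convergence (𝓕 := 𝓝 ρ)
    (f := fun (σ : AdmissibleDensity N m) i => (densityMeasure ρ.toFun (q ⁻¹' {i}) -
      densityMeasure σ.toFun (q ⁻¹' {i})).toReal) (g := fun _ => 0)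
    (ENNReal.summable_toReal hsum) (fun i => ?_) (Eventually.of_forall fun σ i => ?_)
  · simpa using h
  · have h1 := ENNReal.Tendsto.sub (tendsto_const_nhds (x := densityMeasure ρ.toFun (q ⁻¹' {i})))
      (ρ.tendsto_densityMeasure_apply (hq (measurableSet_singleton i)) (hfin i))
      (Or.inl (measure_ne_top _ _))
    rw [tsub_self] at h1
    exact (ENNReal.tendsto_toReal ENNReal.zero_ne_top).comp h1
  · rw [Real.norm_of_nonneg ENNReal.toReal_nonneg]
    exact ENNReal.toReal_mono (measure_ne_top _ _) (hle σ i)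

end AdmissibleDensity

theorem tsum_sub_eq_tsum_sub_of_tsum_eq {ι : Type*} {r s : ι → ℝ≥0∞}
    (h : ∑' i, r i = ∑' i, s i) (hfin : ∑' i, r i ≠ ∞) :
    ∑' i, (r i - s i) = ∑' i, (s i - r i) := by
  refine (ENNReal.add_right_inj hfin).1 ?_
  conv_lhs => rw [h]
  rw [← ENNReal.tsum_add, ← ENNReal.tsum_add]
  exact tsum_congr fun i => by rw [add_tsub_eq_max, add_tsub_eq_max, max_comm]

/-! ### Continuity of the energy -/

variable {m : ℝ≥0}

theorem energy_ne_top (hN : 1 ≤ N) {p : ℝ} (hp : 1 ≤ p) (ρ : AdmissibleDensity N m) :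
    energy p ρ.toFun ≠ ∞ := by
  have := ρ.isFiniteMeasure
  obtain ⟨L, hL, hroom⟩ := exists_le_volume_cubeIndex_preimage hN
    (ENNReal.mul_ne_top (a := 2) (by simp) (ENNReal.coe_ne_top (r := m)))
  rw [ρ.energy_eq hp]
  exact planEnergy_ne_top ρ.densityMeasure_le_volume (measurable_cubeIndex L)
    (edist_le_of_cubeIndex_eq hL) ENNReal.ofReal_ne_top hp (volume_cubeIndex_preimage_ne_top hL)
    fun i => by rw [ρ.densityMeasure_univ]; exact hroom i

theorem continuous_energy (hN : 1 ≤ N) {p : ℝ} (hp : 1 ≤ p) :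
    Continuous fun ρ : AdmissibleDensity N m => energy p ρ.toFun := by
  refine continuous_iff_continuousAt.2 fun ρ => ?_
  refine (ENNReal.tendsto_nhds (energy_ne_top hN hp ρ)).2 fun η hη => ?_
  have hη2 : η / 2 ≠ 0 := (ENNReal.half_pos hη.ne').ne'
  obtain ⟨L, hL, hroom⟩ := exists_le_volume_cubeIndex_preimage hN
    (ENNReal.mul_ne_top (a := 2) (by simp) (ENNReal.coe_ne_top (r := m)))
  have hmp : (m : ℝ≥0∞) ^ (1 / p) ≠ ∞ :=
    ENNReal.rpow_ne_top_of_nonneg (by positivity) ENNReal.coe_ne_top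
  -- a grid so fine that rearranging within its cells costs at most `η / 2`
  obtain ⟨δ, hδη, hδ⟩ : ∃ δ : ℝ, 2 * ENNReal.ofReal (N * δ) * (m : ℝ≥0∞) ^ (1 / p) ≤ η / 2 ∧
      0 < δ := by
    have hlim : Tendsto (fun δ : ℝ => 2 * ENNReal.ofReal (N * δ) * (m : ℝ≥0∞) ^ (1 / p))
        (𝓝[>] 0) (𝓝 (2 * ENNReal.ofReal (N * 0) * (m : ℝ≥0∞) ^ (1 / p))) :=
      tendsto_nhdsWithin_of_tendsto_nhds (ENNReal.Tendsto.mul_const (ENNReal.Tendsto.const_mul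
        (ENNReal.tendsto_ofReal (tendsto_id.const_mul _)) (Or.inr (by simp))) (Or.inr hmp))
    simp only [mul_zero, ENNReal.ofReal_zero, zero_mul] at hlim
    exact ((hlim.eventually (ge_mem_nhds (pos_iff_ne_zero.2 hη2))).and
      eventually_mem_nhdsWithin).exists
  have hqm := measurable_cubeIndex (N := N) δ
  have hstab : ∀ σ τ : AdmissibleDensity N m, energy p τ.toFun ≤ energy p σ.toFun +
      (η / 2 + 2 * ENNReal.ofReal (N * L) *
        (2 * ∑' i, (densityMeasure τ.toFun (cubeIndex δ ⁻¹' {i}) -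
          densityMeasure σ.toFun (cubeIndex δ ⁻¹' {i}))) ^ (1 / p)) := fun σ τ => by
    have := σ.isFiniteMeasure
    have := τ.isFiniteMeasure
    rw [σ.energy_eq hp, τ.energy_eq hp]
    refine (planEnergy_le_add (μ := densityMeasure σ.toFun) τ.densityMeasure_le_volume hqm
      (edist_le_of_cubeIndex_eq hδ) (volume_cubeIndex_preimage_ne_top hδ) (measurable_cubeIndex L)
      (edist_le_of_cubeIndex_eq hL) (volume_cubeIndex_preimage_ne_top hL)
      (fun i => by rw [τ.densityMeasure_univ]; exact hroom i) hp).trans ?_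
    gcongr
    rwa [σ.densityMeasure_univ]
  have hlim : Tendsto (fun σ : AdmissibleDensity N m => 2 * ENNReal.ofReal (N * L) *
      (2 * ∑' i, (densityMeasure ρ.toFun (cubeIndex δ ⁻¹' {i}) -
        densityMeasure σ.toFun (cubeIndex δ ⁻¹' {i}))) ^ (1 / p)) (𝓝 ρ)
      (𝓝 (2 * ENNReal.ofReal (N * L) * (2 * 0) ^ (1 / p))) :=
    ENNReal.Tendsto.const_mul ((ENNReal.continuous_rpow_const.tendsto _).comp
      (ENNReal.Tendsto.const_mul
        (ρ.tendsto_tsum_sub hqm (volume_cubeIndex_preimage_ne_top hδ)) (Or.inr (by simp))))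
      (Or.inr (ENNReal.mul_ne_top (by simp) ENNReal.ofReal_ne_top))
  rw [mul_zero, ENNReal.zero_rpow_of_pos (by positivity), mul_zero] at hlim
  filter_upwards [hlim.eventually (ge_mem_nhds (pos_iff_ne_zero.2 hη2))] with σ hσ
  have htot : ∀ τ : AdmissibleDensity N m,
      ∑' i, densityMeasure τ.toFun (cubeIndex δ ⁻¹' {i}) = m := fun τ => by
    rw [← τ.densityMeasure_univ]
    simpa using tsum_measure_preimage_singleton_inter (densityMeasure τ.toFun) hqm Set.univ
  have hsymm := tsum_sub_eq_tsum_sub_of_tsum_eq ((htot ρ).trans (htot σ).symm)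
    (by rw [htot]; exact ENNReal.coe_ne_top)
  refine ⟨tsub_le_iff_right.2 ((hstab σ ρ).trans ?_), (hstab ρ σ).trans ?_⟩
  · calc _ ≤ energy p σ.toFun + (η / 2 + η / 2) := by gcongr
      _ = _ := by rw [ENNReal.add_halves]
  · rw [← hsymm]
    calc _ ≤ energy p ρ.toFun + (η / 2 + η / 2) := by gcongr
      _ = _ := by rw [ENNReal.add_halves]

/-! ### Approximation by sets -/

theorem setEnergy_eq_energy (hN : 1 ≤ N) {p : ℝ} (hp : 1 ≤ p) (E : AdmissibleSet N m) :
    setEnergy p E.carrier = energy p E.toDensity.toFun := by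
  rw [E.toDensity.energy_eq hp, setEnergy_eq_planEnergy hN hp E.measurableSet
    (by rw [E.volume_eq]; exact ENNReal.coe_ne_top)]
  exact congrArg _ (densityMeasure_indicator E.measurableSet).symm

theorem dist_integral_le_of_map_eq {X ι : Type*} [MeasurableSpace X] [MeasurableSpace ι]
    [Countable ι] [MeasurableSingletonClass ι] {q : X → ι} (hq : Measurable q)
    {μ ν : Measure X} [IsFiniteMeasure μ] [IsFiniteMeasure ν] (h : μ.map q = ν.map q)
    {f : X → ℝ} (hμ : Integrable f μ) (hν : Integrable f ν) {η : ℝ}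
    (hf : ∀ x y, q x = q y → dist (f x) (f y) ≤ η) :
    dist (∫ x, f x ∂μ) (∫ x, f x ∂ν) ≤ η * μ.real Set.univ + η * ν.real Set.univ := by
  classical
  -- a function of the cell alone that is close to `f`
  let g : ι → ℝ := fun i => if h : ∃ x, q x = i then f h.choose else 0
  have hg : ∀ x, ‖f x - g (q x)‖ ≤ η := fun x => by
    have hx : ∃ y, q y = q x := ⟨x, rfl⟩
    simp only [g, dif_pos hx, ← dist_eq_norm]
    exact hf _ _ hx.choose_spec.symm
  have hgm : Measurable g := measurable_of_countable g
  have hgi : ∀ (κ : Measure X) [IsFiniteMeasure κ], Integrable f κ →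
      Integrable (fun x => g (q x)) κ := fun κ _ hκ => by
    have hsub : Integrable (fun x => f x - g (q x)) κ :=
      Integrable.of_bound (hκ.aestronglyMeasurable.sub
        (hgm.comp hq).aestronglyMeasurable) η (Eventually.of_forall hg)
    exact (hκ.sub hsub).congr (Eventually.of_forall fun x => by simp)
  have hclose : ∀ (κ : Measure X) [IsFiniteMeasure κ], Integrable f κ →
      dist (∫ x, f x ∂κ) (∫ x, g (q x) ∂κ) ≤ η * κ.real Set.univ := fun κ _ hκ => by
    rw [dist_eq_norm, ← integral_sub hκ (hgi κ hκ)]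
    exact norm_integral_le_of_norm_le_const (Eventually.of_forall hg)
  have heq : ∫ x, g (q x) ∂μ = ∫ x, g (q x) ∂ν := by
    rw [← integral_map hq.aemeasurable hgm.aestronglyMeasurable, h,
      integral_map hq.aemeasurable hgm.aestronglyMeasurable]
  have h1 := hclose μ hμ
  have h2 := hclose ν hν
  rw [← heq] at h2
  exact (dist_triangle_right _ _ _).trans (add_le_add h1 h2)

/-- Characteristic functions are weak* dense: choose in each cell of a fine grid a set whose volume
is the mass that `ρ` has there. -/
theorem exists_tendsto_toDensity (hN : 1 ≤ N) (ρ : AdmissibleDensity N m) :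
    ∃ E : ℕ → AdmissibleSet N m, Tendsto (fun n => (E n).toDensity) atTop (𝓝 ρ) := by
  have := ρ.isFiniteMeasure
  have hδ : ∀ n : ℕ, (0 : ℝ) < 1 / ((n : ℝ) + 1) := fun n => Nat.one_div_pos_of_nat
  have hq := fun n : ℕ => measurable_cubeIndex (N := N) (1 / ((n : ℝ) + 1))
  choose F _ hFm hF using fun n : ℕ => exists_subset_volume_inter_cube_eq hN (hδ n)
    MeasurableSet.univ
    (b := fun i => densityMeasure ρ.toFun (cubeIndex (1 / ((n : ℝ) + 1)) ⁻¹' {i}))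
    fun i => by rw [Measure.restrict_univ]; exact ρ.densityMeasure_le_volume _
  have hvol : ∀ n, volume (F n) = m := fun n => by
    have h1 := tsum_measure_preimage_singleton_inter (volume.restrict (F n)) (hq n) Set.univ
    have h2 := tsum_measure_preimage_singleton_inter (densityMeasure ρ.toFun) (hq n) Set.univ
    simp only [Set.inter_univ, hF] at h1 h2
    rw [h2, ρ.densityMeasure_univ, Measure.restrict_apply_univ] at h1
    exact h1.symm
  let E : ℕ → AdmissibleSet N m := fun n => ⟨F n, hFm n, hvol n⟩
  have hE : ∀ n, densityMeasure (E n).toDensity.toFun = volume.restrict (F n) := fun n =>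
    densityMeasure_indicator (hFm n)
  refine ⟨E, AdmissibleDensity.tendsto_nhds_iff.2 fun φ => Metric.tendsto_nhds.2 fun η hη => ?_⟩
  -- an oscillation `ε` in each cell costs at most `2 ε m`; the summand `1` covers `m = 0`
  set ε : ℝ := η / (2 * m + 1) with hε
  have hε0 : 0 < ε := by positivity
  obtain ⟨r, hr, hφ⟩ := Metric.uniformContinuous_iff.1
    (ZeroAtInftyContinuousMap.uniformContinuous φ) ε hε0
  have hlim : Tendsto (fun n : ℕ => (N : ℝ) * (1 / ((n : ℝ) + 1))) atTop (𝓝 (N * 0)) :=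
    tendsto_one_div_add_atTop_nhds_zero_nat.const_mul _
  rw [mul_zero] at hlim
  filter_upwards [hlim.eventually (gt_mem_nhds hr)] with n hn
  have := (E n).toDensity.isFiniteMeasure
  have hbdd : ∀ (κ : Measure (EuclideanSpace ℝ (Fin N))) [IsFiniteMeasure κ],
      Integrable (fun x => φ x) κ := fun κ _ =>
    Integrable.of_bound (map_continuous φ).aestronglyMeasurable ‖φ.toBCF‖
      (Eventually.of_forall fun x => φ.toBCF.norm_coe_le_norm x)
  rw [← AdmissibleDensity.integral_densityMeasure, ← AdmissibleDensity.integral_densityMeasure]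
  have h := dist_integral_le_of_map_eq (hq n) (μ := densityMeasure (E n).toDensity.toFun)
    (ν := densityMeasure ρ.toFun)
    (map_eq_map_of_preimage_singleton (hq n) (hq n) fun i => by rw [hE, hF])
    (hbdd _) (hbdd _) (η := ε) fun x y hxy => (hφ (lt_of_le_of_lt ?_ hn)).le
  · refine h.trans_lt ?_
    simp only [measureReal_def, AdmissibleDensity.densityMeasure_univ, ENNReal.coe_toReal]
    calc ε * m + ε * m < ε * (2 * m + 1) := by linarith
      _ = η := div_mul_cancel₀ _ (by positivity)
  · have := edist_le_of_cubeIndex_eq (hδ n) x y hxy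
    rw [edist_dist] at this
    exact (ENNReal.ofReal_le_ofReal_iff (by positivity)).1 this

end WassersteinEnergy

theorem mainTheorem5 (N : ℕ) (hN : 1 ≤ N) (p : ℝ) (hp : 1 ≤ p) (m : ℝ≥0) :
    (∀ ρ : WassersteinEnergy.AdmissibleDensity N m, WassersteinEnergy.energy p ρ.toFun ≠ ⊤) ∧
    (1 < p → ∀ (ρ : WassersteinEnergy.AdmissibleDensity N m)
      (ρn : ℕ → WassersteinEnergy.AdmissibleDensity N m), Tendsto ρn atTop (𝓝 ρ) →
      Tendsto (fun n => WassersteinEnergy.energy p (ρn n).toFun) atTop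
        (𝓝 (WassersteinEnergy.energy p ρ.toFun))) ∧
    WassersteinEnergy.IsLscEnvelope
      (fun ρ : WassersteinEnergy.AdmissibleDensity N m => WassersteinEnergy.extendedSetEnergy p ρ)
      (fun ρ : WassersteinEnergy.AdmissibleDensity N m => WassersteinEnergy.energy p ρ.toFun) ∧
    (∀ ρ : WassersteinEnergy.AdmissibleDensity N m,
      IsLeast {L : ℝ≥0∞ | ∃ E : ℕ → WassersteinEnergy.AdmissibleSet N m,
          Tendsto (fun n => (E n).toDensity) atTop (𝓝 ρ) ∧
          L = liminf (fun n => WassersteinEnergy.setEnergy p (E n).carrier) atTop}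
        (WassersteinEnergy.energy p ρ.toFun)) := by
  have hcont := WassersteinEnergy.continuous_energy (m := m) hN hp
  have hset : ∀ {ρ : WassersteinEnergy.AdmissibleDensity N m}
      {E : ℕ → WassersteinEnergy.AdmissibleSet N m},
      Tendsto (fun n => (E n).toDensity) atTop (𝓝 ρ) →
      Tendsto (fun n => WassersteinEnergy.setEnergy p (E n).carrier) atTop
        (𝓝 (WassersteinEnergy.energy p ρ.toFun)) := fun {ρ E} hE => by
    simp only [WassersteinEnergy.setEnergy_eq_energy hN hp]
    exact (hcont.tendsto ρ).comp hE
  refine ⟨WassersteinEnergy.energy_ne_top hN hp, fun _ ρ ρn h => (hcont.tendsto ρ).comp h,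
    ⟨⟨hcont.lowerSemicontinuous, fun ρ => ?_⟩, fun H hH ρ => ?_⟩, fun ρ => ⟨?_, ?_⟩⟩
  · refine le_iInf fun E => le_iInf fun hE => ?_
    change WassersteinEnergy.energy p ρ.toFun ≤ _
    rw [WassersteinEnergy.setEnergy_eq_energy hN hp, ρ.energy_eq hp, E.toDensity.energy_eq hp,
      WassersteinEnergy.densityMeasure_congr hE]
  · obtain ⟨E, hE⟩ := WassersteinEnergy.exists_tendsto_toDensity hN ρ
    refine le_of_forall_lt_imp_le_of_dense fun c hc => ge_of_tendsto (hset hE) ?_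
    filter_upwards [hE.eventually (hH.1 ρ c hc)] with n hn
    exact hn.le.trans ((hH.2 _).trans (iInf₂_le (E n) EventuallyEq.rfl))
  · obtain ⟨E, hE⟩ := WassersteinEnergy.exists_tendsto_toDensity hN ρ
    exact ⟨E, hE, (hset hE).liminf_eq.symm⟩
  · rintro L ⟨E, hE, rfl⟩
    exact (hset hE).liminf_eq.ge
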